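/- Let $F$ be a non-archimedean local field of characteristic $2$, and let $E/F$ be a totally (wildly) ramified separable quadratic extension with discriminant $\mathfrak p_F^{d+1}$, where $\mathfrak p_F$ is the maximal ideal of the ring of integers of $F$ (necessarily $d>0$ and $d$ is odd). Let $\tau$ be the non-trivial element of $\mathrm{Gal}(E/F)$. For $L=F,E$ let $\mathscr B_L$ be the (reduced) Bruhat--Tits building of $\mathrm{GL}_2$ over $L$, which is a tree whose points are the homothety classes of norms on $L^2$; $\tau$ acts naturally on $\mathscr B_E$. Let $\iota\colon\mathscr B_F\hookrightarrow\mathscr B_E$ be the natural embedding (extension of scalars of norms), and regard $\iota(\mathscr B_F)$ as a subcomplex of $\mathscr B_E$. The distance of an alcove $C$ of $\mathscr B_E$ to a non-empty connected subcomplex $\mathscr C\subseteq\mathscr B_E$ is defined to be $0$ if $C$ is contained in $\mathscr C$; otherwise it is $n+1$, where $n$ is the minimal length of a gallery $(C_0,C_1,\dots,C_n)$ such that $C_0=C$ and $C_n$ is not contained in $\mathscr C$ but has a vertex contained in $\mathscr C$. Then the subcomplex $\mathscr B_E^{\langle\tau\rangle}$ of $\tau$-fixed points of $\mathscr B_E$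 is equal to the closure of the union of all alcoves of $\mathscr B_E$ with distance $\le d$ to $\iota(\mathscr B_F)$. -/

import Mathlib

open scoped NormedField Valued

noncomputable section

namespace BT

/-! ### The Bruhat-Tits building of `GL₂` over a valued field

Points of the (reduced) building are homothety classes of split norms on `K²`. Facets correspond to
the lattice chains formed by the closed balls of a norm. -/

/-- A split norm on `K²`: in a suitable basis of `K²` (whose coordinate functions are the rows of
`g`), it is the maximum of the absolute values of the coordinates, weighted by positive reals. -/
structure SplitNorm (K : Type*) [NormedField K] where
  toFun : (Fin 2 → K) → ℝ
  split : ∃ (g : GL (Fin 2) K) (c₀ c₁ : ℝ), 0 < c₀ ∧ 0 < c₁ ∧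
    ∀ x, toFun x = max (c₀ * ‖(g.1.mulVec x) 0‖) (c₁ * ‖(g.1.mulVec x) 1‖)

/-- Two norms are homothetic if they differ by a positive real factor. -/
instance SplitNorm.setoid (K : Type*) [NormedField K] : Setoid (SplitNorm K) where
  r α β := ∃ t : ℝ, 0 < t ∧ ∀ x, β.toFun x = t * α.toFun x
  iseqv :=
    { refl := fun _ => ⟨1, one_pos, fun _ => (one_mul _).symm⟩
      symm := by
        rintro α β ⟨t, ht, h⟩
        refine ⟨t⁻¹, inv_pos.mpr ht, fun x => ?_⟩
        rw [h x, inv_mul_cancel_left₀ ht.ne']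
      trans := by
        rintro α β γ ⟨t, ht, h⟩ ⟨s, hs, h'⟩
        refine ⟨s * t, mul_pos hs ht, fun x => ?_⟩
        rw [h' x, h x, mul_assoc] }

/-- The set of points of the building of `GL₂` over `K`. -/
def Building (K : Type*) [NormedField K] : Type _ := Quotient (SplitNorm.setoid K)

section Simplicial

variable {K : Type*} [NormedField K]

/-- The lattice chain of a point `p`: all balls `{x | α x ≤ r}`, `r > 0`, of a norm `α` in the
class `p`; equivalently the unit balls of all norms in the class. -/
def chain (p : Building K) : Set (Set (Fin 2 → K)) :=
  {B | ∃ α : SplitNorm K, (Quotient.mk _ α : Building K) = p ∧ B = {x | α.toFun x ≤ 1}}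

/-- The (relatively open) facet containing the point `p`. -/
def facet (p : Building K) : Set (Building K) := {q | chain q = chain p}

/-- The simplicial closure of a set `S`, that is, the union of all closed facets
`{q | chain q ⊆ chain p}` for `p ∈ S`. -/
def cl (S : Set (Building K)) : Set (Building K) := {q | ∃ p ∈ S, chain q ⊆ chain p}

/-- Vertices are the points whose closed facet is reduced to a point. -/
def IsVertex (p : Building K) : Prop := cl {p} = {p}

/-- Alcoves are the (relatively open) facets of maximal dimension, that is, those which do not lie
in the closure of another facet. -/
def IsAlcove (A : Set (Building K)) : Prop :=
  ∃ p, A = facet p ∧ ∀ q, chain p ⊆ chain q → chain q = chain p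

/-- A gallery of length `n` is a sequence of alcoves `Γ 0, …, Γ n` such that consecutive alcoves
share a vertex (the codimension-one faces of alcoves are vertices). -/
def IsGallery (n : ℕ) (Γ : Fin (n + 1) → Set (Building K)) : Prop :=
  (∀ i, IsAlcove (Γ i)) ∧
    ∀ i : Fin n, ∃ v, IsVertex v ∧ v ∈ cl (Γ i.castSucc) ∧ v ∈ cl (Γ i.succ)

/-- The distance of an alcove `A` from a subcomplex `C`: it is `0` if `A` is contained in `C`;
otherwise it is `n + 1`, where `n` is the minimal length of a gallery starting with `A` and ending
with an alcove which is not contained in `C`, but has a vertex in `C`. -/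
def alcoveDist (A C : Set (Building K)) : ℕ∞ :=
  open Classical in
  if A ⊆ C then 0 else
    ⨅ (n : ℕ) (_ : ∃ Γ : Fin (n + 1) → Set (Building K), IsGallery n Γ ∧ Γ 0 = A ∧
      ¬ Γ (Fin.last n) ⊆ C ∧ ∃ v ∈ C, IsVertex v ∧ v ∈ cl (Γ (Fin.last n))), ((n : ℕ∞) + 1)

end Simplicial

theorem mulVec_map_algebraMap {F E : Type*} [Field F] [Field E] [Algebra F E]
    (M : Matrix (Fin 2) (Fin 2) F) (y : Fin 2 → F) :
    (M.map (algebraMap F E)).mulVec (fun j => algebraMap F E (y j)) =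
      fun j => algebraMap F E (M.mulVec y j) := by
  ext j
  simp [Matrix.mulVec, dotProduct]

section Extension

variable (F : Type*) {E : Type*} [NontriviallyNormedField F] [IsUltrametricDist F]
  [NormedField E] [NormedAlgebra F E]

/-- The canonical extension of scalars of a norm `α` on `F²` to `E² = E ⊗ F²`: the value at `x` is
the infimum over all expressions `x = ∑ aᵢ yᵢ`, with `aᵢ ∈ E` and `yᵢ ∈ F²`, of
`maxᵢ |aᵢ| α(yᵢ)`. -/
def extendFun (α : (Fin 2 → F) → ℝ) (x : Fin 2 → E) : ℝ :=
  sInf {r : ℝ | 0 ≤ r ∧ ∃ (n : ℕ) (a : Fin n → E) (y : Fin n → Fin 2 → F),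
    x = ∑ i, a i • (fun j => algebraMap F E (y i j)) ∧ ∀ i, ‖a i‖ * α (y i) ≤ r}

/-- If a basis of `F²` splits `α`, then it also splits the extension of `α` to `E²`. -/
theorem extendFun_eq (α : (Fin 2 → F) → ℝ) (g : GL (Fin 2) F) (c₀ c₁ : ℝ) (h₀ : 0 < c₀)
    (h₁ : 0 < c₁)
    (h : ∀ x, α x = max (c₀ * ‖(g.1.mulVec x) 0‖) (c₁ * ‖(g.1.mulVec x) 1‖)) (x : Fin 2 → E) :
    extendFun F α x =
      max (c₀ * ‖((Matrix.GeneralLinearGroup.map (algebraMap F E) g).1.mulVec x) 0‖)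
        (c₁ * ‖((Matrix.GeneralLinearGroup.map (algebraMap F E) g).1.mulVec x) 1‖) := by
  have : IsUltrametricDist E := IsUltrametricDist.of_normedAlgebra F
  have hmap : (Matrix.GeneralLinearGroup.map (algebraMap F E) g).1 =
      g.1.map (algebraMap F E) := rfl
  rw [hmap]
  have hc : ∀ j : Fin 2, 0 < (![c₀, c₁] : Fin 2 → ℝ) j := by
    intro j; fin_cases j <;> simpa
  have hα : ∀ (y : Fin 2 → F) (j : Fin 2), ![c₀, c₁] j * ‖(g.1.mulVec y) j‖ ≤ α y := by
    intro y j
    rw [h]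
    fin_cases j
    · exact le_max_left _ _
    · exact le_max_right _ _
  have hfin : ∀ j : Fin 2, ![c₀, c₁] j * ‖((g.1.map (algebraMap F E)).mulVec x) j‖ ≤
      max (c₀ * ‖((g.1.map (algebraMap F E)).mulVec x) 0‖)
        (c₁ * ‖((g.1.map (algebraMap F E)).mulVec x) 1‖) := by
    intro j
    fin_cases j
    · exact le_max_left _ _
    · exact le_max_right _ _
  apply IsLeast.csInf_eq
  refine ⟨⟨le_max_of_le_left (by positivity), 2, fun j => ((g.1.map (algebraMap F E)).mulVec x) j,
    fun j => (g⁻¹).1.mulVec (Pi.single j 1), ?_, ?_⟩, ?_⟩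
  · have hinv : ((g⁻¹).1.map (algebraMap F E)) * (g.1.map (algebraMap F E)) = 1 := by
      rw [← Matrix.map_mul]
      have : (g⁻¹).1 * g.1 = 1 := by rw [← Units.val_mul]; simp
      rw [this]; simp
    have hx : x = ((g⁻¹).1.map (algebraMap F E)).mulVec
        ((g.1.map (algebraMap F E)).mulVec x) := by
      rw [Matrix.mulVec_mulVec, hinv, Matrix.one_mulVec]
    conv_lhs => rw [hx]
    ext k
    rw [Matrix.mulVec, dotProduct]
    simp [mul_comm]
  · intro j
    have hj : α ((g⁻¹).1.mulVec (Pi.single j 1)) = ![c₀, c₁] j := by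
      rw [h, Matrix.mulVec_mulVec]
      have : g.1 * (g⁻¹).1 = 1 := by rw [← Units.val_mul]; simp
      rw [this, Matrix.one_mulVec]
      fin_cases j
      · simp [h₀.le]
      · simp [h₁.le]
    rw [hj, mul_comm]
    exact hfin j
  · rintro r ⟨hr, n, a, y, hx, hle⟩
    have key : ∀ j : Fin 2, ![c₀, c₁] j * ‖((g.1.map (algebraMap F E)).mulVec x) j‖ ≤ r := by
      intro j
      have hxj : ((g.1.map (algebraMap F E)).mulVec x) j =
          ∑ i, a i * algebraMap F E (g.1.mulVec (y i) j) := by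
        rw [hx, Matrix.mulVec_sum, Finset.sum_apply]
        refine Finset.sum_congr rfl fun i _ => ?_
        rw [Matrix.mulVec_smul, mulVec_map_algebraMap]
        rfl
      rw [hxj, ← le_div_iff₀' (hc j)]
      refine IsUltrametricDist.norm_sum_le_of_forall_le_of_nonneg
        (div_nonneg hr (hc j).le) fun i _ => ?_
      rw [le_div_iff₀' (hc j), norm_mul, norm_algebraMap', mul_left_comm]
      exact (mul_le_mul_of_nonneg_left (hα (y i) j) (norm_nonneg _)).trans (hle i)
    exact max_le (key 0) (key 1)

/-- Extension of scalars of split norms. -/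
def SplitNorm.extend (α : SplitNorm F) : SplitNorm E where
  toFun := extendFun F α.toFun
  split := by
    obtain ⟨g, c₀, c₁, h₀, h₁, h⟩ := α.split
    exact ⟨_, c₀, c₁, h₀, h₁, extendFun_eq F α.toFun g c₀ c₁ h₀ h₁ h⟩

variable (E) in
/-- The natural embedding of the building over `F` into the building over `E`. -/
def iota : Building F → Building E :=
  Quotient.map (SplitNorm.extend F) (by
    rintro α β ⟨t, ht, h⟩
    obtain ⟨g, c₀, c₁, h₀, h₁, hα⟩ := α.split
    refine ⟨t, ht, fun x => ?_⟩
    have hβ : ∀ x, β.toFun x =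
        max (t * c₀ * ‖(g.1.mulVec x) 0‖) (t * c₁ * ‖(g.1.mulVec x) 1‖) := by
      intro x
      rw [h x, hα x, mul_max_of_nonneg _ _ ht.le, mul_assoc, mul_assoc]
    change extendFun F β.toFun x = t * extendFun F α.toFun x
    rw [extendFun_eq F β.toFun g _ _ (mul_pos ht h₀) (mul_pos ht h₁) hβ,
      extendFun_eq F α.toFun g _ _ h₀ h₁ hα, mul_max_of_nonneg _ _ ht.le, mul_assoc, mul_assoc])

variable {F} [CompleteSpace F] [Algebra.IsAlgebraic F E]

/-- Automorphisms of `E/F` are isometries. -/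
theorem norm_algEquiv (σ : E ≃ₐ[F] E) (x : E) : ‖σ x‖ = ‖x‖ := by
  rw [NormedAlgebra.norm_eq_spectralNorm F, NormedAlgebra.norm_eq_spectralNorm F,
    ← spectralNorm_eq_of_equiv]

/-- The action of an automorphism `σ` of `E/F` on split norms: `(σ • α)(x) = α(σ⁻¹ x)`, where `σ`
acts on `E²` coordinatewise. -/
def SplitNorm.galois (σ : E ≃ₐ[F] E) (α : SplitNorm E) : SplitNorm E where
  toFun x := α.toFun fun j => σ.symm (x j)
  split := by
    obtain ⟨g, c₀, c₁, h₀, h₁, h⟩ := α.split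
    refine ⟨Matrix.GeneralLinearGroup.map (σ : E →+* E) g, c₀, c₁, h₀, h₁, fun x => ?_⟩
    have key : ∀ j, ‖(g.1.mulVec fun j => σ.symm (x j)) j‖ =
        ‖((Matrix.GeneralLinearGroup.map (σ : E →+* E) g).1.mulVec x) j‖ := by
      intro j
      rw [← norm_algEquiv σ]
      congr 1
      simp [Matrix.mulVec, dotProduct]
    rw [h, key, key]

/-- The natural action of an automorphism `σ` of `E/F` on the building over `E`. -/
def galois (σ : E ≃ₐ[F] E) : Building E → Building E :=
  Quotient.map (SplitNorm.galois σ) (by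
    rintro α β ⟨t, ht, h⟩
    exact ⟨t, ht, fun x => h _⟩)

end Extension

/-! ### Ramification -/

section Ramification

variable (F E : Type*) [NontriviallyNormedField F] [IsUltrametricDist F]
  [NormedField E] [NormedAlgebra F E]

/-- `E/F` is totally ramified: the extension of residue fields is trivial, that is, every integral
element of `E` is congruent to an element of `F` modulo the maximal ideal. -/
def IsTotallyRamified : Prop := ∀ x : E, ‖x‖ ≤ 1 → ∃ y : F, ‖x - algebraMap F E y‖ < 1

/-- The discriminant of `E/F`: the ideal of the ring of integers of `F` generated by the
discriminants of all `[E : F]`-tuples of integral elements of `E`. -/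
def discIdeal : Ideal 𝒪[F] :=
  Ideal.span {x | ∃ b : Fin (Module.finrank F E) → E, (∀ i, ‖b i‖ ≤ 1) ∧
    (x : F) = Algebra.discr F b}

end Ramification

end BT

end

open scoped NormedField Valued

/-! Every point of the tree over a field `K` is a disc in `K`: a centre `a` and a radius `r`, the
centre mattering only up to distance `r`. The image of `iota` consists of the discs with a centre in
`F`, and `τ` moves the centre and keeps the radius. So a disc is fixed iff `‖τ a - a‖ ≤ r`, and it
lies in the image iff the distance from `a` to `F` is at most `r`. The arithmetic input
(`exists_valueGenerator`) is that this distance equals `‖τ a - a‖ * Q ^ d`, where `Q` is the inverse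
norm of a uniformizer `π` of `E`. Writing `a = x + y π` with `x`, `y` in `F`, the distance is `‖y
π‖`, while `τ a - a = y (τ π - π)`; the discriminant yields `‖τ π - π‖ = ‖π‖ ^ (d + 1)`. Hence the
fixed discs are those whose radius, enlarged by the factor `Q ^ d`, gives a disc in the image. The
combinatorial input (`nbhd_eq_cl`) identifies this set with the alcoves at distance at most `d`:
passing to an adjacent alcove changes the exponent of the radius by at most one step, and enlarging
the radius around a fixed centre is a shortest way to the image. -/

namespace BT

/-! ### Points of the building as discs -/

section Disc

variable {K : Type*} [NormedField K]

/-- The norm `x ↦ max (‖x₀ - a x₁‖) (r ‖x₁‖)` attached to the disc with centre `a` and radius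
`r`. -/
noncomputable def discNorm (a : K) (r : ℝ) (hr : 0 < r) : SplitNorm K where
  toFun x := max ‖x 0 - a * x 1‖ (r * ‖x 1‖)
  split := by
    refine ⟨Matrix.GeneralLinearGroup.mkOfDetNeZero !![1, -a; 0, 1] (by simp), 1, r, one_pos, hr,
      fun x => ?_⟩
    simp [Matrix.GeneralLinearGroup.mkOfDetNeZero, Matrix.mulVec, dotProduct, sub_eq_add_neg]

/-- The point of the building attached to the disc with centre `a` and radius `r`. -/
noncomputable def disc (a : K) (r : ℝ) (hr : 0 < r) : Building K :=
  Quotient.mk _ (discNorm a r hr)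

theorem mk_eq_iff {α β : SplitNorm K} :
    (Quotient.mk _ α : Building K) = Quotient.mk _ β ↔
      ∃ t : ℝ, 0 < t ∧ ∀ x, β.toFun x = t * α.toFun x :=
  Quotient.eq

variable [IsUltrametricDist K]

theorem max_norm_add_eq {u v : K} {c : ℝ} (h : ‖v‖ ≤ c) : max ‖u + v‖ c = max ‖u‖ c := by
  apply le_antisymm
  · exact max_le ((IsUltrametricDist.norm_add_le_max u v).trans (max_le_max le_rfl h))
      (le_max_right _ _)
  · refine max_le ?_ (le_max_right _ _)
    have := IsUltrametricDist.norm_add_le_max (u + v) (-v)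
    rw [add_neg_cancel_right, norm_neg] at this
    exact this.trans (max_le_max le_rfl h)

theorem disc_eq_iff {a b : K} {r s : ℝ} {hr : 0 < r} {hs : 0 < s} :
    disc a r hr = disc b s hs ↔ r = s ∧ ‖a - b‖ ≤ r := by
  refine mk_eq_iff.trans ⟨?_, ?_⟩
  · rintro ⟨t, -, h⟩
    -- The vector `(1, 0)` forces the homothety factor to be 1. The radius is then the least value
    -- on vectors with second coordinate 1, attained at the centre.
    have h1 := h ![1, 0]
    have h2 := h ![a, 1]
    have h3 := h ![b, 1]
    simp only [discNorm, Matrix.cons_val_zero, Matrix.cons_val_one, mul_zero, sub_zero, norm_one,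
      norm_zero, mul_one, sub_self] at h1 h2 h3
    rw [max_eq_left zero_le_one, mul_one] at h1
    rw [← h1, one_mul, max_eq_right hr.le] at h2
    rw [← h1, one_mul, max_eq_right hs.le] at h3
    have h4 : s ≤ r := h2 ▸ le_max_right _ _
    have h5 : r ≤ s := h3 ▸ le_max_right _ _
    exact ⟨le_antisymm h5 h4, h2 ▸ le_max_left _ _⟩
  · rintro ⟨rfl, h⟩
    refine ⟨1, one_pos, fun x => ?_⟩
    have : x 0 - b * x 1 = (x 0 - a * x 1) + (a - b) * x 1 := by ring
    simp only [discNorm]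
    rw [this, one_mul, max_norm_add_eq]
    rw [norm_mul]
    gcongr

/-- Gaussian elimination with the dominant entry `p` as pivot: by `hle`, the multiple of the first
row removed from the second is absorbed by the maximum. The zero of the first row is the centre. -/
theorem mk_eq_disc {α : SplitNorm K} {p q s t : K} {c₀ c₁ : ℝ} (h₀ : 0 < c₀) (h₁ : 0 < c₁)
    (hdet : p * t - q * s ≠ 0)
    (h : ∀ x, α.toFun x = max (c₀ * ‖p * x 0 + q * x 1‖) (c₁ * ‖s * x 0 + t * x 1‖))
    (hle : c₁ * ‖s‖ ≤ c₀ * ‖p‖) : ∃ a r hr, (Quotient.mk _ α : Building K) = disc a r hr := by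
  have hp : p ≠ 0 := by
    rintro rfl
    have hs : s = 0 := by
      rw [norm_zero, mul_zero] at hle
      exact norm_le_zero_iff.mp (nonpos_of_mul_nonpos_right hle h₁)
    simp [hs] at hdet
  have hp' : 0 < ‖p‖ := norm_pos_iff.mpr hp
  have hm : t - s * (q / p) ≠ 0 := by
    intro h0
    apply hdet
    field_simp at h0
    linear_combination h0
  have hm' : 0 < ‖t - s * (q / p)‖ := norm_pos_iff.mpr hm
  refine ⟨-(q / p), c₁ * ‖t - s * (q / p)‖ / (c₀ * ‖p‖), by positivity, Eq.symm (mk_eq_iff.mpr ?_)⟩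
  refine ⟨c₀ * ‖p‖, by positivity, fun x => ?_⟩
  have e0 : p * x 0 + q * x 1 = p * (x 0 - -(q / p) * x 1) := by field_simp; ring
  have e1 : s * x 0 + t * x 1 =
      (t - s * (q / p)) * x 1 + s * (x 0 - -(q / p) * x 1) := by ring
  set z := x 0 - -(q / p) * x 1 with hz
  set m := t - s * (q / p) with hmdef
  have h2 : ‖s * z‖ ≤ c₀ * ‖p‖ * ‖z‖ / c₁ := by
    rw [le_div_iff₀ h₁, norm_mul]
    nlinarith [norm_nonneg z, mul_le_mul_of_nonneg_right hle (norm_nonneg z)]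
  have h3 := congrArg (c₁ * ·) (max_norm_add_eq (u := m * x 1) h2)
  simp only [mul_max_of_nonneg _ _ h₁.le, mul_div_cancel₀ _ h₁.ne'] at h3
  simp only [discNorm, ← hz]
  rw [h, e0, e1, mul_max_of_nonneg _ _ (by positivity), norm_mul p, max_comm, ← mul_assoc c₀, h3,
    max_comm, norm_mul]
  congr 1
  rw [← mul_assoc (c₀ * ‖p‖), mul_div_cancel₀ _ (mul_pos h₀ hp').ne', mul_assoc]

theorem exists_eq_disc (p : Building K) : ∃ a r hr, p = disc a r hr := by
  induction p using Quotient.inductionOn with | _ α => ?_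
  obtain ⟨g, c₀, c₁, h₀, h₁, h⟩ := α.split
  have hdet : g.1 0 0 * g.1 1 1 - g.1 0 1 * g.1 1 0 ≠ 0 := by
    rw [← Matrix.det_fin_two]
    exact g.det.ne_zero
  simp only [Matrix.mulVec, dotProduct, Fin.sum_univ_two] at h
  rcases le_total (c₁ * ‖g.1 1 0‖) (c₀ * ‖g.1 0 0‖) with hle | hle
  · exact mk_eq_disc h₀ h₁ hdet h hle
  · refine mk_eq_disc h₁ h₀ (p := g.1 1 0) (q := g.1 1 1) (s := g.1 0 0) (t := g.1 0 1) ?_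
      (fun x => (h x).trans (max_comm _ _)) hle
    intro h0
    apply hdet
    linear_combination -h0

omit [IsUltrametricDist K] in
theorem mem_chain_disc {a : K} {r : ℝ} {hr : 0 < r} {B : Set (Fin 2 → K)} :
    B ∈ chain (disc a r hr) ↔
      ∃ t : ℝ, 0 < t ∧ B = {x | ‖x 0 - a * x 1‖ ≤ t ∧ ‖x 1‖ ≤ t / r} := by
  have key : ∀ t : ℝ, 0 < t → ∀ x : Fin 2 → K, t⁻¹ * (discNorm a r hr).toFun x ≤ 1 ↔
      ‖x 0 - a * x 1‖ ≤ t ∧ ‖x 1‖ ≤ t / r := by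
    intro t ht x
    rw [inv_mul_le_iff₀ ht, mul_one, le_div_iff₀' hr]
    exact max_le_iff
  constructor
  · rintro ⟨α, hα, rfl⟩
    obtain ⟨t, ht, h⟩ := mk_eq_iff.mp hα.symm
    refine ⟨t⁻¹, inv_pos.mpr ht, ?_⟩
    ext x
    rw [Set.mem_ofPred_eq, Set.mem_ofPred_eq, ← key _ (inv_pos.mpr ht), inv_inv, h]
  · rintro ⟨t, ht, rfl⟩
    let α : SplitNorm K :=
      { toFun := fun x => t⁻¹ * (discNorm a r hr).toFun x
        split := by
          obtain ⟨g, c₀, c₁, h₀, h₁, h⟩ := (discNorm a r hr).split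
          refine ⟨g, t⁻¹ * c₀, t⁻¹ * c₁, by positivity, by positivity, fun x => ?_⟩
          rw [h, mul_max_of_nonneg _ _ (by positivity), mul_assoc, mul_assoc] }
    refine ⟨α, Eq.symm (mk_eq_iff.mpr ⟨t⁻¹, inv_pos.mpr ht, fun _ => rfl⟩), ?_⟩
    ext x
    exact (key t ht x).symm

end Disc

/-! ### Extension of scalars and Galois action on discs -/

section Functoriality

variable {F E : Type*} [NontriviallyNormedField F] [IsUltrametricDist F]
  [NormedField E] [NormedAlgebra F E]

theorem iota_disc (a : F) (r : ℝ) (hr : 0 < r) :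
    iota F E (disc a r hr) = disc (algebraMap F E a) r hr := by
  refine mk_eq_iff.mpr ⟨1, one_pos, fun x => ?_⟩
  have h := extendFun_eq (E := E) F (discNorm a r hr).toFun
    (Matrix.GeneralLinearGroup.mkOfDetNeZero !![1, -a; 0, 1] (by simp)) 1 r one_pos hr
    (fun x => by
      simp [discNorm, Matrix.GeneralLinearGroup.mkOfDetNeZero, Matrix.mulVec, dotProduct,
        sub_eq_add_neg]) x
  refine Eq.trans ?_ (congrArg (1 * ·) h).symm
  simp [discNorm, Matrix.GeneralLinearGroup.mkOfDetNeZero, Matrix.mulVec, dotProduct,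
    sub_eq_add_neg]

theorem range_iota : Set.range (iota F E) =
    {p | ∃ (a : F) (r : ℝ) (hr : 0 < r), p = disc (algebraMap F E a) r hr} := by
  ext p
  constructor
  · rintro ⟨q, rfl⟩
    obtain ⟨a, r, hr, rfl⟩ := exists_eq_disc q
    exact ⟨a, r, hr, iota_disc a r hr⟩
  · rintro ⟨a, r, hr, rfl⟩
    exact ⟨disc a r hr, iota_disc a r hr⟩

variable [CompleteSpace F] [Algebra.IsAlgebraic F E]

theorem galois_disc (σ : E ≃ₐ[F] E) (a : E) (r : ℝ) (hr : 0 < r) :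
    galois σ (disc a r hr) = disc (σ a) r hr := by
  refine mk_eq_iff.mpr ⟨1, one_pos, fun x => ?_⟩
  change max ‖x 0 - σ a * x 1‖ (r * ‖x 1‖) =
    1 * max ‖σ.symm (x 0) - a * σ.symm (x 1)‖ (r * ‖σ.symm (x 1)‖)
  rw [one_mul, norm_algEquiv σ.symm, ← norm_algEquiv σ (σ.symm (x 0) - _)]
  simp

end Functoriality

/-! ### Facets in terms of discs, for a discrete value group -/

section Chain

variable {K : Type*} [NormedField K]

/-- `Q` generates the value group of `K`. -/
structure IsValueGenerator (K : Type*) [NormedField K] (Q : ℝ) : Prop where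
  one_lt : 1 < Q
  exists_norm : ∀ n : ℤ, ∃ x : K, ‖x‖ = Q ^ n
  norm_eq : ∀ x : K, x ≠ 0 → ∃ n : ℤ, ‖x‖ = Q ^ n

variable {Q : ℝ} (hQ : IsValueGenerator K Q)

namespace IsValueGenerator

include hQ

theorem pos : 0 < Q := one_pos.trans hQ.one_lt

theorem norm_le_rpow_iff (x : K) (u : ℝ) : ‖x‖ ≤ Q ^ u ↔ ‖x‖ ≤ Q ^ ⌊u⌋ := by
  rcases eq_or_ne x 0 with rfl | hx
  · simp [(Real.rpow_pos_of_pos hQ.pos u).le, (zpow_pos hQ.pos ⌊u⌋).le]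
  · obtain ⟨n, hn⟩ := hQ.norm_eq x hx
    rw [hn, zpow_le_zpow_iff_right₀ hQ.one_lt, ← Real.rpow_intCast,
      Real.rpow_le_rpow_left_iff hQ.one_lt, Int.le_floor]

/-- The point of the building attached to the disc with centre `a` and radius `Q ^ ρ`. -/
noncomputable def pt (a : K) (ρ : ℝ) : Building K := disc a (Q ^ ρ) (Real.rpow_pos_of_pos hQ.pos ρ)

theorem disc_eq_pt (a : K) (r : ℝ) (hr : 0 < r) : disc a r hr = hQ.pt a (Real.logb Q r) := by
  unfold pt
  congr
  exact (Real.rpow_logb hQ.pos hQ.one_lt.ne' hr).symm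

end IsValueGenerator

/-- The lattice `{x | ‖x₀ - a x₁‖ ≤ Q ^ i, ‖x₁‖ ≤ Q ^ j}`. -/
def discLattice (Q : ℝ) (a : K) (i j : ℤ) : Set (Fin 2 → K) :=
  {x | ‖x 0 - a * x 1‖ ≤ Q ^ i ∧ ‖x 1‖ ≤ Q ^ j}

namespace IsValueGenerator

include hQ

/-- Values are discrete, so the ball of radius `Q ^ u` only sees `⌊u⌋` and `⌊u - ρ⌋`. For a fixed
centre the chain thus depends only on `⌊ρ⌋` and `⌈ρ⌉`. -/
theorem mem_chain_pt {a : K} {ρ : ℝ} {B : Set (Fin 2 → K)} :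
    B ∈ chain (hQ.pt a ρ) ↔
      ∃ i j : ℤ, ⌊ρ⌋ ≤ i - j ∧ i - j ≤ ⌈ρ⌉ ∧ B = discLattice Q a i j := by
  have key : ∀ u : ℝ, {x : Fin 2 → K | ‖x 0 - a * x 1‖ ≤ Q ^ u ∧ ‖x 1‖ ≤ Q ^ u / Q ^ ρ} =
      discLattice Q a ⌊u⌋ ⌊u - ρ⌋ := by
    intro u
    ext x
    rw [← Real.rpow_sub hQ.pos]
    simp only [discLattice, Set.mem_ofPred_eq, ← hQ.norm_le_rpow_iff]
  rw [pt, mem_chain_disc]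
  constructor
  · rintro ⟨t, ht, rfl⟩
    obtain ⟨u, rfl⟩ : ∃ u, t = Q ^ u := ⟨_, (Real.rpow_logb hQ.pos hQ.one_lt.ne' ht).symm⟩
    refine ⟨⌊u⌋, ⌊u - ρ⌋, ?_, ?_, key u⟩
    · rw [← Int.lt_add_one_iff, Int.floor_lt]
      push_cast
      linarith [Int.floor_le (u - ρ), Int.lt_floor_add_one u]
    · rw [← Int.sub_one_lt_iff, Int.lt_ceil]
      push_cast
      linarith [Int.lt_floor_add_one (u - ρ), Int.floor_le u]
  · rintro ⟨i, j, h1, h2, rfl⟩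
    rw [← Int.lt_add_one_iff, Int.floor_lt] at h1
    rw [← Int.sub_one_lt_iff, Int.lt_ceil] at h2
    push_cast at h1 h2
    -- The least `u` with `⌊u⌋ ≥ i` and `⌊u - ρ⌋ ≥ j`; the two bounds on `i - j` make both
    -- equalities.
    refine ⟨Q ^ (max (i : ℝ) (j + ρ)), Real.rpow_pos_of_pos hQ.pos _, ?_⟩
    rw [key]
    have e1 : ⌊max (i : ℝ) (j + ρ)⌋ = i := by
      rw [Int.floor_eq_iff]
      exact ⟨le_max_left _ _, max_lt (by linarith) (by linarith)⟩
    have e2 : ⌊max (i : ℝ) (j + ρ) - ρ⌋ = j := by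
      rw [Int.floor_eq_iff]
      refine ⟨by linarith [le_max_right (i : ℝ) (j + ρ)], ?_⟩
      rw [sub_lt_iff_lt_add]
      exact max_lt (by linarith) (by linarith)
    rw [e1, e2]

theorem discLattice_subset {a b : K} {i j i' j' : ℤ}
    (h : discLattice Q a i j ⊆ discLattice Q b i' j') :
    i ≤ i' ∧ j ≤ j' ∧ ‖a - b‖ ≤ Q ^ (i' - j) := by
  obtain ⟨x, hx⟩ := hQ.exists_norm i
  obtain ⟨y, hy⟩ := hQ.exists_norm j
  have hpos : ∀ n : ℤ, 0 < Q ^ n := fun n => zpow_pos hQ.pos n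
  have h1 : ![x, 0] ∈ discLattice Q b i' j' := h (by simp [discLattice, hx, (hpos j).le])
  have h2 : ![a * y, y] ∈ discLattice Q b i' j' := h (by simp [discLattice, hy, (hpos i).le])
  simp only [discLattice, Set.mem_ofPred_eq, Matrix.cons_val_zero, Matrix.cons_val_one, mul_zero,
    sub_zero, ← sub_mul, norm_mul, hx, hy] at h1 h2
  refine ⟨(zpow_le_zpow_iff_right₀ hQ.one_lt).mp h1.1,
    (zpow_le_zpow_iff_right₀ hQ.one_lt).mp h2.2, ?_⟩
  rw [zpow_sub₀ hQ.pos.ne', le_div_iff₀ (hpos j)]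
  exact h2.1

variable [IsUltrametricDist K]

theorem discLattice_eq {a b : K} {i j : ℤ} (h : ‖a - b‖ ≤ Q ^ (i - j)) :
    discLattice Q a i j = discLattice Q b i j := by
  ext x
  refine and_congr_left fun hx => ?_
  have e : x 0 - b * x 1 = (x 0 - a * x 1) + (a - b) * x 1 := by ring
  have hle : ‖(a - b) * x 1‖ ≤ Q ^ i := by
    rw [norm_mul]
    calc _ ≤ Q ^ (i - j) * Q ^ j := mul_le_mul h hx (norm_nonneg _) (zpow_pos hQ.pos _).le
      _ = Q ^ i := by rw [← zpow_add₀ hQ.pos.ne', sub_add_cancel]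
  have := max_norm_add_eq (u := x 0 - a * x 1) hle
  rw [← e] at this
  rw [← max_eq_right_iff, ← this, max_eq_right_iff]

theorem pt_eq_pt_iff {a b : K} {ρ σ : ℝ} :
    hQ.pt a ρ = hQ.pt b σ ↔ ρ = σ ∧ ‖a - b‖ ≤ Q ^ ρ := by
  unfold pt
  rw [disc_eq_iff, Real.rpow_right_inj hQ.pos hQ.one_lt.ne']

theorem exists_eq_pt (p : Building K) : ∃ a ρ, p = hQ.pt a ρ := by
  obtain ⟨a, r, hr, rfl⟩ := exists_eq_disc p
  exact ⟨a, _, hQ.disc_eq_pt a r hr⟩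

theorem chain_subset_iff {a b : K} {ρ σ : ℝ} :
    chain (hQ.pt b σ) ⊆ chain (hQ.pt a ρ) ↔
      ⌊ρ⌋ ≤ ⌊σ⌋ ∧ ⌈σ⌉ ≤ ⌈ρ⌉ ∧ ‖b - a‖ ≤ Q ^ ⌊σ⌋ := by
  constructor
  · intro h
    -- Lattices with second exponent 0 suffice as tests; `k = ⌊σ⌋` gives the sharpest bound on the
    -- centres.
    have step : ∀ k : ℤ, ⌊σ⌋ ≤ k → k ≤ ⌈σ⌉ → ⌊ρ⌋ ≤ k ∧ k ≤ ⌈ρ⌉ ∧ ‖b - a‖ ≤ Q ^ k := by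
      intro k h1 h2
      have hmem : discLattice Q b k 0 ∈ chain (hQ.pt b σ) :=
        hQ.mem_chain_pt.mpr ⟨k, 0, by simpa, by simpa, rfl⟩
      obtain ⟨i, j, h3, h4, h5⟩ := hQ.mem_chain_pt.mp (h hmem)
      obtain ⟨h6, h7, h8⟩ := hQ.discLattice_subset h5.subset
      obtain ⟨h9, h10, -⟩ := hQ.discLattice_subset h5.superset
      obtain rfl : i = k := le_antisymm h9 h6
      obtain rfl : j = 0 := le_antisymm h10 h7
      rw [sub_zero] at h3 h4 h8
      exact ⟨h3, h4, h8⟩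
    have hfc := Int.floor_le_ceil σ
    exact ⟨(step _ le_rfl hfc).1, (step _ hfc le_rfl).2.1, (step _ le_rfl hfc).2.2⟩
  · rintro ⟨h1, h2, h3⟩ B hB
    obtain ⟨i, j, h4, h5, rfl⟩ := hQ.mem_chain_pt.mp hB
    exact hQ.mem_chain_pt.mpr ⟨i, j, h1.trans h4, h5.trans h2, hQ.discLattice_eq
      (h3.trans (zpow_le_zpow_right₀ hQ.one_lt.le h4))⟩

theorem eq_pt_of_chain_subset {a : K} {ρ : ℝ} {q : Building K}
    (h : chain q ⊆ chain (hQ.pt a ρ)) :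
    ∃ σ, q = hQ.pt a σ ∧ ⌊ρ⌋ ≤ ⌊σ⌋ ∧ ⌈σ⌉ ≤ ⌈ρ⌉ := by
  obtain ⟨b, σ, rfl⟩ := hQ.exists_eq_pt q
  obtain ⟨h1, h2, h3⟩ := hQ.chain_subset_iff.mp h
  exact ⟨σ, hQ.pt_eq_pt_iff.mpr ⟨rfl, (hQ.norm_le_rpow_iff _ _).mpr h3⟩, h1, h2⟩

theorem isVertex_pt (a : K) (n : ℤ) : IsVertex (hQ.pt a n) := by
  ext q
  simp only [cl, Set.mem_singleton_iff, exists_eq_left, Set.mem_ofPred_eq]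
  refine ⟨fun h => ?_, fun h => h ▸ subset_rfl⟩
  obtain ⟨σ, rfl, h1, h2⟩ := hQ.eq_pt_of_chain_subset h
  rw [Int.floor_intCast, Int.le_floor] at h1
  rw [Int.ceil_intCast, Int.ceil_le] at h2
  rw [le_antisymm h2 h1]

/-- For non-integral `ρ` the differences `i - j` in the chain take two consecutive values, and no
chain has more. -/
theorem isAlcove_facet_pt (a : K) {ρ : ℝ} (hρ : ⌊ρ⌋ < ⌈ρ⌉) : IsAlcove (facet (hQ.pt a ρ)) := by
  refine ⟨_, rfl, fun q hq => Set.Subset.antisymm ?_ hq⟩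
  obtain ⟨b, σ, rfl⟩ := hQ.exists_eq_pt q
  obtain ⟨h1, h2, h3⟩ := hQ.chain_subset_iff.mp hq
  have h4 := Int.ceil_le_floor_add_one σ
  have h5 : ⌊σ⌋ = ⌊ρ⌋ := by lia
  have h6 : ⌈σ⌉ = ⌈ρ⌉ := by lia
  exact hQ.chain_subset_iff.mpr ⟨h5.ge, h6.le, by rwa [h5, norm_sub_rev]⟩

end IsValueGenerator

end Chain

/-! ### Uniformizers and powers of the maximal ideal -/

section Arithmetic

/-- The open unit ball is also closed, hence compact, so the norm attains a maximum on it. A norm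
strictly between two consecutive powers would, after rescaling, beat this maximum. -/
theorem exists_uniformizer {K : Type*} [NormedField K] [IsUltrametricDist K] [ProperSpace K]
    (hK : ∃ x : K, x ≠ 0 ∧ ‖x‖ < 1) :
    ∃ π : K, π ≠ 0 ∧ ‖π‖ < 1 ∧ ∀ x : K, x ≠ 0 → ∃ n : ℤ, ‖x‖ = ‖π‖ ^ n := by
  obtain ⟨x₀, hx₀, hx₀'⟩ := hK
  have hcpt : IsCompact (Metric.ball (0 : K) 1) :=
    Metric.isCompact_of_isClosed_isBounded (IsUltrametricDist.isClosed_ball 0 1)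
      Metric.isBounded_ball
  obtain ⟨π, hπ, hmax⟩ := hcpt.exists_isMaxOn ⟨x₀, by simpa⟩ continuous_norm.continuousOn
  have hπ1 : ‖π‖ < 1 := by simpa using hπ
  have hle : ∀ x : K, ‖x‖ < 1 → ‖x‖ ≤ ‖π‖ := fun x hx => hmax (by simpa using hx)
  have hπ0 : 0 < ‖π‖ := (norm_pos_iff.mpr hx₀).trans_le (hle _ hx₀')
  refine ⟨π, norm_pos_iff.mp hπ0, hπ1, fun x hx => ?_⟩
  obtain ⟨n, h1, h2⟩ := exists_mem_Ico_zpow (norm_pos_iff.mpr hx) ((one_lt_inv₀ hπ0).mpr hπ1)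
  rw [inv_zpow'] at h1 h2
  refine ⟨-n, le_antisymm ?_ h1⟩
  by_contra! hlt
  have h3 : ‖π ^ (-n) * x⁻¹‖ < 1 := by
    rwa [norm_mul, norm_zpow, norm_inv, ← div_eq_mul_inv, div_lt_one (norm_pos_iff.mpr hx)]
  have h4 := hle _ h3
  rw [norm_mul, norm_zpow, norm_inv, ← div_eq_mul_inv, div_le_iff₀ (norm_pos_iff.mpr hx)] at h4
  rw [neg_add, zpow_add₀ hπ0.ne', zpow_neg_one, ← div_eq_mul_inv, lt_div_iff₀ hπ0, mul_comm] at h2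
  exact h4.not_gt h2

theorem mem_maximalIdeal_pow_iff {F : Type*} [NontriviallyNormedField F] [IsUltrametricDist F]
    {p : F} (hp : p ≠ 0) (hp1 : ‖p‖ < 1) (hgen : ∀ x : F, x ≠ 0 → ∃ n : ℤ, ‖x‖ = ‖p‖ ^ n) (n : ℕ)
    (x : 𝒪[F]) : x ∈ IsLocalRing.maximalIdeal 𝒪[F] ^ n ↔ ‖(x : F)‖ ≤ ‖p‖ ^ n := by
  have hp0 : 0 < ‖p‖ := norm_pos_iff.mpr hp
  have hint : ∀ y : F, y ∈ 𝒪[F] ↔ ‖y‖ ≤ 1 := fun y => Valued.integer.mem_iff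
  have hdvd : ∀ a b : 𝒪[F], (a : F) ≠ 0 → (a ∣ b ↔ ‖(b : F)‖ ≤ ‖(a : F)‖) := by
    intro a b ha
    constructor
    · rintro ⟨c, rfl⟩
      have := (hint c).mp c.2
      simpa using mul_le_mul_of_nonneg_left this (norm_nonneg (a : F))
    · intro h
      refine ⟨⟨(b : F) / a, (hint _).mpr ?_⟩, ?_⟩
      · rw [norm_div]
        exact div_le_one_of_le₀ h (norm_nonneg _)
      · ext
        simp [mul_div_cancel₀ _ ha]
  have hmax : IsLocalRing.maximalIdeal 𝒪[F] = Ideal.span {⟨p, (hint p).mpr hp1.le⟩} := by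
    ext y
    rw [IsLocalRing.mem_maximalIdeal, mem_nonunits_iff, Valued.integer.isUnit_iff_norm_eq_one,
      Ideal.mem_span_singleton, hdvd _ _ hp]
    change ¬ ‖(y : F)‖ = 1 ↔ ‖(y : F)‖ ≤ ‖p‖
    refine ⟨fun h => ?_, fun h => (h.trans_lt hp1).ne⟩
    have hlt : ‖(y : F)‖ < 1 := lt_of_le_of_ne ((hint y).mp y.2) h
    rcases eq_or_ne (y : F) 0 with h0 | h0
    · simp [h0]
    · obtain ⟨n, hn⟩ := hgen _ h0
      rw [hn] at hlt ⊢
      have : 0 < n := (zpow_lt_one_iff_right_of_lt_one₀ hp0 hp1).mp hlt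
      calc ‖p‖ ^ n ≤ ‖p‖ ^ (1 : ℤ) := (zpow_le_zpow_iff_right_of_lt_one₀ hp0 hp1).mpr this
        _ = ‖p‖ := zpow_one _
  rw [hmax, Ideal.span_singleton_pow, Ideal.mem_span_singleton, hdvd]
  · simp
  · simpa using pow_ne_zero n hp

/-! ### Trace, norm and discriminant in a quadratic extension -/

section Quadratic

variable {F E : Type*} [Field F] [Field E] [Algebra F E] [FiniteDimensional F E]
  (hdeg : Module.finrank F E = 2) {τ : E ≃ₐ[F] E} (hτ : τ ≠ 1)

include hdeg hτ

theorem isGalois_of_finrank_eq_two : IsGalois F E := by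
  apply IsGalois.of_card_aut_eq_finrank
  rw [hdeg]
  have : Nontrivial (E ≃ₐ[F] E) := ⟨τ, 1, hτ⟩
  have h1 := Finite.one_lt_card (α := E ≃ₐ[F] E)
  have h2 := AlgEquiv.card_le (F := F) (K := E)
  rw [hdeg, ← Nat.card_eq_fintype_card] at h2
  exact le_antisymm h2 h1

theorem algEquiv_eq_one_or (σ : E ≃ₐ[F] E) : σ = 1 ∨ σ = τ := by
  have := isGalois_of_finrank_eq_two hdeg hτ
  have h := IsGalois.card_aut_eq_finrank F E
  rw [hdeg, Nat.card_eq_two_iff' 1] at h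
  obtain ⟨ρ, -, hρ⟩ := h
  by_contra! hσ
  exact hσ.2 ((hρ σ hσ.1).trans (hρ τ hτ).symm)

open Classical in
theorem univ_algEquiv_eq : (Finset.univ : Finset (E ≃ₐ[F] E)) = {1, τ} := by
  ext σ
  simpa using algEquiv_eq_one_or hdeg hτ σ

theorem algebraMap_trace_eq (x : E) : algebraMap F E (Algebra.trace F E x) = x + τ x := by
  classical
  have := isGalois_of_finrank_eq_two hdeg hτ
  rw [trace_eq_sum_automorphisms, univ_algEquiv_eq hdeg hτ, Finset.sum_pair (Ne.symm hτ)]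
  rfl

theorem algebraMap_norm_eq (x : E) : algebraMap F E (Algebra.norm F x) = x * τ x := by
  classical
  have := isGalois_of_finrank_eq_two hdeg hτ
  rw [Algebra.norm_eq_prod_automorphisms, univ_algEquiv_eq hdeg hτ, Finset.prod_pair (Ne.symm hτ)]
  rfl

/-- The length is a variable `n` so that the formula applies to tuples indexed by `Fin
(Module.finrank F E)`. -/
theorem algebraMap_discr_eq {n : ℕ} (hn : n = 2) (b : Fin n → E) :
    algebraMap F E (Algebra.discr F b) =
      (b ⟨0, by lia⟩ * τ (b ⟨1, by lia⟩) - b ⟨1, by lia⟩ * τ (b ⟨0, by lia⟩)) ^ 2 := by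
  subst hn
  rw [Algebra.discr_def, Matrix.det_fin_two]
  simp only [Algebra.traceMatrix_apply, Algebra.traceForm_apply, map_sub, map_mul,
    algebraMap_trace_eq hdeg hτ]
  change _ = (b 0 * τ (b 1) - b 1 * τ (b 0)) ^ 2
  ring

end Quadratic

/-! ### Total ramification, and the displacement of a uniformizer -/

section Ramified

variable {F E : Type*} [NontriviallyNormedField F] [IsUltrametricDist F]
    [ProperSpace F] [NormedField E] [NormedAlgebra F E] [FiniteDimensional F E]

omit [IsUltrametricDist F] in
-- Take `z = a - x` with `a` outside `F` and `x` a nearest point of `F`. If `‖z‖ = ‖f‖`, total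
-- ramification approximates `z / f` by some `y` in `F`, and `x + f y` is strictly nearer to `a`.
theorem exists_norm_ne (hdeg : Module.finrank F E = 2) (hram : IsTotallyRamified F E) :
    ∃ z : E, z ≠ 0 ∧ ∀ f : F, ‖z‖ ≠ ‖f‖ := by
  have : ProperSpace E := FiniteDimensional.proper F E
  let R : Submodule F E := LinearMap.range (Algebra.linearMap F E)
  have hR : R ≠ ⊤ := by
    intro h
    have h1 := LinearMap.finrank_range_le (Algebra.linearMap F E)
    rw [show LinearMap.range (Algebra.linearMap F E) = ⊤ from h, finrank_top, hdeg,
      Module.finrank_self] at h1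
    lia
  obtain ⟨a, -, ha⟩ := SetLike.exists_of_lt (lt_top_iff_ne_top.mpr hR)
  obtain ⟨_, ⟨x, rfl⟩, hx⟩ := (Submodule.closed_of_finiteDimensional R).exists_infDist_eq_dist
    ⟨0, R.zero_mem⟩ a
  have hmin : ∀ y : F, ‖a - algebraMap F E x‖ ≤ ‖a - algebraMap F E y‖ := by
    intro y
    have := Metric.infDist_le_dist_of_mem (x := a) (show algebraMap F E y ∈ (R : Set E) from ⟨y, rfl⟩)
    rwa [hx, dist_eq_norm, dist_eq_norm] at this
  have hz : a - algebraMap F E x ≠ 0 := fun h => ha ⟨x, (sub_eq_zero.mp h).symm⟩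
  refine ⟨_, hz, fun f hf => ?_⟩
  have hf0 : 0 < ‖f‖ := hf ▸ norm_pos_iff.mpr hz
  have hf' : algebraMap F E f ≠ 0 := by simpa using norm_pos_iff.mp hf0
  obtain ⟨y, hy⟩ := hram ((a - algebraMap F E x) / algebraMap F E f)
    (by rw [norm_div, hf, norm_algebraMap', div_self hf0.ne'])
  refine (hmin (x + f * y)).not_gt ?_
  have e : a - algebraMap F E (x + f * y) = algebraMap F E f *
      ((a - algebraMap F E x) / algebraMap F E f - algebraMap F E y) := by
    rw [mul_sub, mul_div_cancel₀ _ hf', map_add, map_mul]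
    ring
  rw [e, norm_mul, norm_algebraMap', hf]
  exact mul_lt_of_lt_one_right hf0 hy

variable [IsUltrametricDist E]

omit [IsUltrametricDist F] [ProperSpace F] [FiniteDimensional F E] in
theorem norm_add_mul_eq_max {π : E} (hπF : ∀ f : F, ‖π‖ ≠ ‖f‖) (x y : F) :
    ‖algebraMap F E x + algebraMap F E y * π‖ = max ‖x‖ (‖y‖ * ‖π‖) := by
  rcases eq_or_ne y 0 with rfl | hy
  · simp
  rw [← norm_algebraMap' E x, ← norm_algebraMap' E y, ← norm_mul]
  apply IsUltrametricDist.norm_add_eq_max_of_norm_ne_norm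
  intro h
  rw [norm_mul, norm_algebraMap', norm_algebraMap'] at h
  apply hπF (x / y)
  rw [norm_div, h, mul_div_cancel_left₀ _ (norm_ne_zero_iff.mpr hy)]

omit [IsUltrametricDist F] [ProperSpace F] [FiniteDimensional F E] in
theorem exists_eq_add_mul (hdeg : Module.finrank F E = 2) {π : E} (hπ : π ≠ 0)
    (hπF : ∀ f : F, ‖π‖ ≠ ‖f‖) (a : E) :
    ∃ x y : F, a = algebraMap F E x + algebraMap F E y * π := by
  have hli : LinearIndependent F ![(1 : E), π] := by
    rw [LinearIndependent.pair_iff]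
    intro s t h
    rw [Algebra.smul_def, Algebra.smul_def, mul_one] at h
    have h1 := norm_add_mul_eq_max hπF s t
    rw [h, norm_zero] at h1
    have h2 : ‖s‖ ≤ 0 := h1 ▸ le_max_left _ _
    have h3 : ‖t‖ * ‖π‖ ≤ 0 := h1 ▸ le_max_right _ _
    exact ⟨norm_le_zero_iff.mp h2, norm_le_zero_iff.mp
      (nonpos_of_mul_nonpos_left h3 (norm_pos_iff.mpr hπ))⟩
  have hspan := hli.span_eq_top_of_card_eq_finrank (by simp [hdeg])
  have ha : a ∈ Submodule.span F (Set.range ![(1 : E), π]) := hspan ▸ Submodule.mem_top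
  rw [Matrix.range_cons_cons_empty, Submodule.mem_span_pair] at ha
  obtain ⟨x, y, h⟩ := ha
  refine ⟨x, y, ?_⟩
  rw [← h, Algebra.smul_def, Algebra.smul_def, mul_one]

/-- Since `1, π` is an integral basis, every discriminant of an integral pair is `(τ π - π) ^ 2`
times the square of an integral element of `F`. Comparison with the given power of the maximal ideal
yields the norm. -/
theorem norm_sub_eq_of_discIdeal (hdeg : Module.finrank F E = 2) {τ : E ≃ₐ[F] E} (hτ : τ ≠ 1)
    {π : E} (hπ : π ≠ 0) (hπ1 : ‖π‖ < 1) (hπF : ∀ f : F, ‖π‖ ≠ ‖f‖)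
    (hgen : ∀ x : E, x ≠ 0 → ∃ n : ℤ, ‖x‖ = ‖π‖ ^ n)
    {d : ℕ} (hdisc : discIdeal F E = IsLocalRing.maximalIdeal 𝒪[F] ^ (d + 1)) :
    ‖τ π - π‖ = ‖π‖ ^ (d + 1) := by
  have hπ0 : 0 < ‖π‖ := norm_pos_iff.mpr hπ
  -- A uniformizer of `F`: its norm is `‖π‖ ^ 2`, and an odd power of `‖π‖` cannot be a norm from
  -- `F`, as then `‖π‖` would be one too.
  set p : F := Algebra.norm F π with hpdef
  have hpnorm : ‖p‖ = ‖π‖ ^ 2 := by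
    rw [← norm_algebraMap' E, hpdef, algebraMap_norm_eq hdeg hτ, norm_mul, norm_algEquiv, sq]
  have hp0 : 0 < ‖p‖ := by rw [hpnorm]; positivity
  have hp1 : ‖p‖ < 1 := by rw [hpnorm]; exact pow_lt_one₀ hπ0.le hπ1 two_ne_zero
  have hpgen : ∀ x : F, x ≠ 0 → ∃ n : ℤ, ‖x‖ = ‖p‖ ^ n := by
    intro x hx
    obtain ⟨m, hm⟩ := hgen (algebraMap F E x) (by simpa)
    rw [norm_algebraMap'] at hm
    obtain ⟨k, rfl | rfl⟩ := Int.even_or_odd' m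
    · exact ⟨k, by rw [hm, hpnorm, zpow_mul, zpow_ofNat]⟩
    · exfalso
      apply hπF (x * p ^ (-k))
      rw [norm_mul, norm_zpow, hm, hpnorm, ← zpow_natCast, ← zpow_mul, ← zpow_add₀ hπ0.ne']
      simp
  have hint : ∀ y : F, y ∈ 𝒪[F] ↔ ‖y‖ ≤ 1 := fun y => Valued.integer.mem_iff
  have hmem := mem_maximalIdeal_pow_iff (norm_pos_iff.mp hp0) hp1 hpgen (d + 1)
  have hmem2 : ∀ x : 𝒪[F], x ∈ discIdeal F E ↔ ‖(x : F)‖ ≤ (‖π‖ ^ (d + 1)) ^ 2 := by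
    intro x
    rw [hdisc, hmem, hpnorm, ← pow_mul, ← pow_mul, mul_comm]
  -- By parity: `2 n + 1 ≥ 0` forces `n ≥ 0`. Hence integral elements have integral coordinates in
  -- the basis `1, π`.
  have hy1 : ∀ y : F, ‖y‖ * ‖π‖ ≤ 1 → ‖y‖ ≤ 1 := by
    intro y hy
    rcases eq_or_ne y 0 with rfl | h0
    · simp
    obtain ⟨n, hn⟩ := hpgen y h0
    rw [hn] at hy ⊢
    rw [hpnorm, ← zpow_natCast, ← zpow_mul, ← zpow_add_one₀ hπ0.ne',
      zpow_le_one_iff_right_of_lt_one₀ hπ0 hπ1] at hy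
    rw [zpow_le_one_iff_right_of_lt_one₀ hp0 hp1]
    push_cast at hy
    lia
  apply le_antisymm
  · let b : Fin (Module.finrank F E) → E := fun i => if i.1 = 0 then 1 else π
    have hb : algebraMap F E (Algebra.discr F b) = (τ π - π) ^ 2 := by
      rw [algebraMap_discr_eq hdeg hτ hdeg]
      simp [b]
    have hnorm : ‖Algebra.discr F b‖ = ‖τ π - π‖ ^ 2 := by
      rw [← norm_algebraMap' E, hb, norm_pow]
    have hle : ‖τ π - π‖ ≤ 1 := by
      rw [sub_eq_add_neg]
      refine (IsUltrametricDist.norm_add_le_max _ _).trans (max_le ?_ ?_)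
      · rw [norm_algEquiv]; exact hπ1.le
      · rw [norm_neg]; exact hπ1.le
    have h1 : ‖Algebra.discr F b‖ ≤ 1 := by
      rw [hnorm]
      exact pow_le_one₀ (norm_nonneg _) hle
    have h2 := (hmem2 ⟨_, (hint _).mpr h1⟩).mp (Ideal.subset_span ⟨b, fun i => by
      dsimp only [b]; split_ifs
      · simp
      · exact hπ1.le, rfl⟩)
    rw [hnorm] at h2
    exact (pow_le_pow_iff_left₀ (norm_nonneg _) (by positivity) two_ne_zero).mp h2
  -- This ideal contains all the discriminants, hence also `p ^ (d + 1)`.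
  · let I : Ideal 𝒪[F] :=
      { carrier := {x | ‖(x : F)‖ ≤ ‖τ π - π‖ ^ 2}
        add_mem' := fun {a b} ha hb => by
          simpa using (IsUltrametricDist.norm_add_le_max (a : F) b).trans (max_le ha hb)
        zero_mem' := by simp
        smul_mem' := fun c x hx => by
          have hc := (hint c).mp c.2
          change ‖((c * x : 𝒪[F]) : F)‖ ≤ _
          rw [Subring.coe_mul, norm_mul]
          exact (mul_le_of_le_one_left (norm_nonneg _) hc).trans hx }
    have hI : discIdeal F E ≤ I := by
      refine Ideal.span_le.mpr ?_
      rintro x ⟨b, hb, hx⟩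
      change ‖(x : F)‖ ≤ _
      rw [hx, ← norm_algebraMap' E, algebraMap_discr_eq hdeg hτ hdeg, norm_pow]
      gcongr
      have h0 := hb ⟨0, by lia⟩
      have h1 := hb ⟨1, by lia⟩
      obtain ⟨x₀, y₀, e₀⟩ := exists_eq_add_mul hdeg hπ hπF (b ⟨0, by lia⟩)
      obtain ⟨x₁, y₁, e₁⟩ := exists_eq_add_mul hdeg hπ hπF (b ⟨1, by lia⟩)
      rw [e₀, norm_add_mul_eq_max hπF, max_le_iff] at h0
      rw [e₁, norm_add_mul_eq_max hπF, max_le_iff] at h1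
      have e : b ⟨0, by lia⟩ * τ (b ⟨1, by lia⟩) - b ⟨1, by lia⟩ * τ (b ⟨0, by lia⟩) =
          algebraMap F E (x₀ * y₁ - x₁ * y₀) * (τ π - π) := by
        rw [e₀, e₁]
        simp only [map_add, map_mul, map_sub, AlgEquiv.commutes]
        ring
      rw [e, norm_mul, norm_algebraMap']
      refine mul_le_of_le_one_left (norm_nonneg _) ?_
      rw [sub_eq_add_neg]
      refine (IsUltrametricDist.norm_add_le_max _ _).trans (max_le ?_ ?_)
      · rw [norm_mul]
        exact mul_le_one₀ h0.1 (norm_nonneg _) (hy1 _ h1.2)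
      · rw [norm_neg, norm_mul]
        exact mul_le_one₀ h1.1 (norm_nonneg _) (hy1 _ h0.2)
    have hpint : ‖p ^ (d + 1)‖ = (‖π‖ ^ (d + 1)) ^ 2 := by
      rw [norm_pow, hpnorm, ← pow_mul, ← pow_mul, mul_comm]
    have h1 : (⟨p ^ (d + 1), (hint _).mpr (by
        rw [norm_pow]; exact pow_le_one₀ hp0.le hp1.le)⟩ : 𝒪[F]) ∈ discIdeal F E :=
      (hmem2 _).mpr hpint.le
    have h2 : ‖p ^ (d + 1)‖ ≤ ‖τ π - π‖ ^ 2 := hI h1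
    rw [hpint] at h2
    exact (pow_le_pow_iff_left₀ (by positivity) (norm_nonneg _) two_ne_zero).mp h2

/-- The last two clauses say that `‖τ a - a‖ * Q ^ d` is the distance from `a` to `F`: apply the
first to `a - x` with `x` in `F`. The exponent is `d`, not `d + 1`, because one factor `‖π‖` belongs
to the distance `‖y‖ * ‖π‖`. -/
theorem exists_valueGenerator (hdeg : Module.finrank F E = 2) (hram : IsTotallyRamified F E)
    (d : ℕ) (hdisc : discIdeal F E = IsLocalRing.maximalIdeal 𝒪[F] ^ (d + 1))
    (τ : E ≃ₐ[F] E) (hτ : τ ≠ 1) :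
    ∃ Q : ℝ, IsValueGenerator E Q ∧ (∀ a : E, ‖τ a - a‖ * Q ^ d ≤ ‖a‖) ∧
      ∀ a : E, ∃ x : F, ‖a - algebraMap F E x‖ ≤ ‖τ a - a‖ * Q ^ d := by
  have : ProperSpace E := FiniteDimensional.proper F E
  obtain ⟨f, hf0, hf1⟩ := NormedField.exists_norm_lt_one F
  obtain ⟨π, hπ, hπ1, hgen⟩ := exists_uniformizer (K := E)
    ⟨algebraMap F E f, by simpa using hf0, by simpa⟩
  have hπ0 : 0 < ‖π‖ := norm_pos_iff.mpr hπ
  have hπF : ∀ f : F, ‖π‖ ≠ ‖f‖ := by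
    intro f hf
    obtain ⟨z, hz, hzF⟩ := exists_norm_ne hdeg hram
    obtain ⟨n, hn⟩ := hgen z hz
    exact hzF (f ^ n) (by rw [hn, norm_zpow, hf])
  have hτπ := norm_sub_eq_of_discIdeal hdeg hτ hπ hπ1 hπF hgen hdisc
  have key : ∀ x y : F, ‖τ (algebraMap F E x + algebraMap F E y * π) -
      (algebraMap F E x + algebraMap F E y * π)‖ * ‖π‖⁻¹ ^ d = ‖y‖ * ‖π‖ := by
    intro x y
    have : τ (algebraMap F E x + algebraMap F E y * π) -
      (algebraMap F E x + algebraMap F E y * π) = algebraMap F E y * (τ π - π) := by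
      simp only [map_add, map_mul, AlgEquiv.commutes]
      ring
    rw [this, norm_mul, hτπ, norm_algebraMap', inv_pow, pow_succ]
    field_simp
  refine ⟨‖π‖⁻¹, ⟨(one_lt_inv₀ hπ0).mpr hπ1, fun n => ⟨π ^ (-n), ?_⟩, fun x hx => ?_⟩, ?_, ?_⟩
  · rw [norm_zpow, inv_zpow']
  · obtain ⟨n, hn⟩ := hgen x hx
    exact ⟨-n, by rw [hn, inv_zpow', neg_neg]⟩
  · intro a
    obtain ⟨x, y, rfl⟩ := exists_eq_add_mul hdeg hπ hπF a
    rw [key, norm_add_mul_eq_max hπF]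
    exact le_max_right _ _
  · intro a
    obtain ⟨x, y, rfl⟩ := exists_eq_add_mul hdeg hπ hπF a
    refine ⟨x, ?_⟩
    rw [key, add_sub_cancel_left, norm_mul, norm_algebraMap']

end Ramified

end Arithmetic

/-! ### Neighbourhoods of a subcomplex and alcove distance -/

section Neighbourhood

variable {K : Type*} [NormedField K] [IsUltrametricDist K]

omit [IsUltrametricDist K] in
theorem cl_facet (p : Building K) : cl (facet p) = {q | chain q ⊆ chain p} := by
  ext q
  constructor
  · rintro ⟨p', hp', h⟩
    exact h.trans_eq hp'
  · exact fun h => ⟨p, rfl, h⟩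

/-- A nonnegative function on `K` which satisfies the properties of the distance to a closed
additive subgroup and takes values in `Q ^ ℤ` (and `0`). -/
structure IsHeight (Q : ℝ) (w : K → ℝ) : Prop where
  le_norm : ∀ a, w a ≤ ‖a‖
  add_le : ∀ a b, w (a + b) ≤ max (w a) (w b)
  eq_zpow : ∀ a, w a = 0 ∨ ∃ n : ℤ, w a = Q ^ n

/-- The points `pt a ρ` for which `w a ≤ Q ^ (ρ + m)`: if `w` is the distance to a subfield, then
these are the points of distance at most `m` to the building over the subfield. -/
def nbhd {Q : ℝ} (hQ : IsValueGenerator K Q) (w : K → ℝ) (m : ℕ) : Set (Building K) :=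
  {p | ∃ a ρ, p = hQ.pt a ρ ∧ w a ≤ Q ^ (ρ + m)}

variable {Q : ℝ} (hQ : IsValueGenerator K Q) {w : K → ℝ} (hw : IsHeight Q w)

include hw in
theorem pt_mem_nbhd {m : ℕ} {a : K} {ρ : ℝ} :
    hQ.pt a ρ ∈ nbhd hQ w m ↔ w a ≤ Q ^ (ρ + m) := by
  refine ⟨?_, fun h => ⟨a, ρ, rfl, h⟩⟩
  rintro ⟨b, σ, h, hb⟩
  obtain ⟨rfl, hab⟩ := hQ.pt_eq_pt_iff.mp h
  have h1 := hw.add_le (a - b) b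
  rw [sub_add_cancel] at h1
  refine h1.trans (max_le (((hw.le_norm _).trans hab).trans ?_) hb)
  exact Real.rpow_le_rpow_of_exponent_le hQ.one_lt.le (by simp)

include hw in
theorem pt_mem_nbhd_iff_floor {m : ℕ} {a : K} {ρ : ℝ} :
    hQ.pt a ρ ∈ nbhd hQ w m ↔ w a ≤ Q ^ (⌊ρ⌋ + m) := by
  rw [pt_mem_nbhd hQ hw]
  rcases hw.eq_zpow a with h | ⟨n, h⟩
  · rw [h]
    exact iff_of_true (Real.rpow_pos_of_pos hQ.pos _).le (zpow_pos hQ.pos _).le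
  · rw [h, zpow_le_zpow_iff_right₀ hQ.one_lt, ← Real.rpow_intCast,
      Real.rpow_le_rpow_left_iff hQ.one_lt, ← sub_le_iff_le_add, ← sub_le_iff_le_add, Int.le_floor]
    push_cast
    rfl

include hw in
theorem mem_nbhd_of_chain_subset {m : ℕ} {p q : Building K} (hp : p ∈ nbhd hQ w m)
    (h : chain q ⊆ chain p) : q ∈ nbhd hQ w m := by
  obtain ⟨a, ρ, rfl⟩ := hQ.exists_eq_pt p
  obtain ⟨σ, rfl, h1, -⟩ := hQ.eq_pt_of_chain_subset h
  rw [pt_mem_nbhd_iff_floor hQ hw] at hp ⊢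
  exact hp.trans (zpow_le_zpow_right₀ hQ.one_lt.le (by lia))

include hw in
theorem cl_subset_nbhd {m : ℕ} {S : Set (Building K)} (hS : S ⊆ nbhd hQ w m) :
    cl S ⊆ nbhd hQ w m := by
  rintro q ⟨p, hp, h⟩
  exact mem_nbhd_of_chain_subset hQ hw (hS hp) h

include hw in
-- Going from a face to a larger facet lowers the floor of the exponent by at most one.
theorem mem_nbhd_succ_of_chain_subset {m : ℕ} {p v : Building K} (hv : v ∈ nbhd hQ w m)
    (h : chain v ⊆ chain p) : p ∈ nbhd hQ w (m + 1) := by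
  obtain ⟨a, ρ, rfl⟩ := hQ.exists_eq_pt p
  obtain ⟨σ, rfl, -, h2⟩ := hQ.eq_pt_of_chain_subset h
  rw [pt_mem_nbhd_iff_floor hQ hw] at hv ⊢
  refine hv.trans (zpow_le_zpow_right₀ hQ.one_lt.le ?_)
  have h3 := Int.floor_le_ceil σ
  have h4 := Int.ceil_le_floor_add_one ρ
  push_cast
  lia

include hw in
theorem IsAlcove.subset_nbhd_succ {m : ℕ} {A : Set (Building K)} (hA : IsAlcove A)
    {v : Building K} (hv : v ∈ nbhd hQ w m) (hvA : v ∈ cl A) : A ⊆ nbhd hQ w (m + 1) := by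
  obtain ⟨p, rfl, -⟩ := hA
  rw [cl_facet] at hvA
  intro q hq
  exact mem_nbhd_succ_of_chain_subset hQ hw hv (hvA.trans_eq hq.symm)

include hw in
theorem subset_nbhd_of_alcoveDist_le {d : ℕ} {A : Set (Building K)}
    (h : alcoveDist A (nbhd hQ w 0) ≤ d) : A ⊆ nbhd hQ w d := by
  have hmono : ∀ {m n : ℕ}, m ≤ n → nbhd hQ w m ⊆ nbhd hQ w n := by
    rintro m n hmn _ ⟨a, ρ, rfl, ha⟩
    refine ⟨a, ρ, rfl, ha.trans (Real.rpow_le_rpow_of_exponent_le hQ.one_lt.le ?_)⟩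
    gcongr
  unfold alcoveDist at h
  split_ifs at h with hA
  · exact hA.trans (hmono d.zero_le)
  obtain ⟨n, ⟨Γ, ⟨hΓA, hΓ⟩, rfl, -, v, hvC, -, hv⟩, hnd⟩ :
      ∃ n : ℕ, (∃ Γ : Fin (n + 1) → Set (Building K), IsGallery n Γ ∧ Γ 0 = A ∧
        ¬ Γ (Fin.last n) ⊆ nbhd hQ w 0 ∧
          ∃ v ∈ nbhd hQ w 0, IsVertex v ∧ v ∈ cl (Γ (Fin.last n))) ∧ n + 1 ≤ d := by
    by_contra! hcon
    have h1 : ((d + 1 : ℕ) : ℕ∞) ≤ d := by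
      refine le_trans (le_iInf₂ fun n hn => ?_) h
      exact_mod_cast hcon n hn
    have h2 : d + 1 ≤ d := by exact_mod_cast h1
    lia
  -- Induction backwards along the gallery. The last alcove meets the subcomplex in a vertex, which
  -- already costs one step: hence `k + 1`.
  have key : ∀ k : ℕ, ∀ i : Fin (n + 1), i.1 + k = n → Γ i ⊆ nbhd hQ w (k + 1) := by
    intro k
    induction k with
    | zero =>
      intro i hi
      obtain rfl : i = Fin.last n := Fin.ext (by simpa using hi)
      exact (hΓA _).subset_nbhd_succ hQ hw hvC hv
    | succ k ih =>
      intro i hi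
      obtain ⟨u, -, hu1, hu2⟩ := hΓ ⟨i.1, by lia⟩
      have h1 := ih (Fin.succ ⟨i.1, by lia⟩) (by simp only [Fin.val_succ]; lia)
      exact (hΓA _).subset_nbhd_succ hQ hw (cl_subset_nbhd hQ hw h1 hu2) hu1
  exact (key n 0 (by simp)).trans (hmono hnd)

include hw in
theorem alcoveDist_facet_le {d : ℕ} {a : K} {ρ : ℝ} (hρ : ⌊ρ⌋ < ⌈ρ⌉)
    (h : hQ.pt a ρ ∈ nbhd hQ w d) : alcoveDist (facet (hQ.pt a ρ)) (nbhd hQ w 0) ≤ d := by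
  unfold alcoveDist
  split_ifs with hC
  · exact zero_le
  have ha : ¬ w a ≤ Q ^ ⌊ρ⌋ := by
    intro ha
    apply hC
    intro q hq
    refine mem_nbhd_of_chain_subset hQ hw ((pt_mem_nbhd_iff_floor hQ hw (a := a) (ρ := ρ)).mpr ?_)
      (subset_of_eq hq)
    simpa using ha
  rw [pt_mem_nbhd_iff_floor hQ hw] at h
  obtain ⟨n, hn⟩ : ∃ n : ℤ, w a = Q ^ n := by
    refine (hw.eq_zpow a).resolve_left fun h0 => ha ?_
    rw [h0]
    exact (zpow_pos hQ.pos _).le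
  rw [hn, zpow_le_zpow_iff_right₀ hQ.one_lt] at ha h
  have hceil : ⌈ρ⌉ = ⌊ρ⌋ + 1 := le_antisymm (Int.ceil_le_floor_add_one ρ) hρ
  have hfl : ∀ i : ℕ, ⌊ρ + i⌋ = ⌊ρ⌋ + i := Int.floor_add_natCast ρ
  have hce : ∀ i : ℕ, ⌈ρ + i⌉ = ⌊ρ⌋ + 1 + i := fun i => by rw [Int.ceil_add_natCast, hceil]
  have hsub : ∀ (i : ℕ) (k : ℤ), ⌊ρ⌋ + i ≤ k → k ≤ ⌊ρ⌋ + 1 + i →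
      hQ.pt a k ∈ cl (facet (hQ.pt a (ρ + i))) := by
    intro i k h1 h2
    rw [cl_facet]
    refine hQ.chain_subset_iff.mpr ⟨by simpa [hfl], by simpa [hce], ?_⟩
    rw [sub_self, norm_zero]
    exact (zpow_pos hQ.pos _).le
  -- With the centre kept at `a`, growing discs enter the subcomplex at radius `Q ^ n = w a`. The
  -- gallery follows this ray; its last alcove has `pt a n` as its upper vertex.
  obtain ⟨N, hN⟩ : ∃ N : ℕ, n = ⌊ρ⌋ + 1 + N := ⟨(n - ⌊ρ⌋ - 1).toNat, by lia⟩
  let Γ : Fin (N + 1) → Set (Building K) := fun i => facet (hQ.pt a (ρ + (i.1 : ℕ)))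
  refine (iInf₂_le N ⟨Γ, ⟨fun i => ?_, fun i => ?_⟩, ?_, ?_, hQ.pt a n, ?_, hQ.isVertex_pt a n,
    ?_⟩).trans ?_
  · have : N + 1 ≤ d := by lia
    exact_mod_cast this
  · exact hQ.isAlcove_facet_pt a (by rw [hfl, hce]; lia)
  · refine ⟨_, hQ.isVertex_pt a (⌊ρ⌋ + 1 + i.1), hsub _ _ ?_ ?_, hsub _ _ ?_ ?_⟩ <;>
      simp only [Fin.val_castSucc, Fin.val_succ] <;> push_cast <;> lia
  · simp [Γ]
  · intro hcon
    have h1 := (pt_mem_nbhd_iff_floor hQ hw).mp (hcon (show _ ∈ facet (hQ.pt a _) from rfl))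
    rw [hn, zpow_le_zpow_iff_right₀ hQ.one_lt, hfl, Fin.val_last] at h1
    push_cast at h1
    lia
  · rw [pt_mem_nbhd_iff_floor hQ hw, hn]
    simp
  · exact hsub _ _ (by simp only [Fin.val_last]; lia) (by simp only [Fin.val_last]; lia)

include hw in
theorem nbhd_eq_cl (d : ℕ) :
    nbhd hQ w d = cl (⋃₀ {A | IsAlcove A ∧ alcoveDist A (nbhd hQ w 0) ≤ (d : ℕ∞)}) := by
  apply Set.Subset.antisymm
  · intro p hp
    obtain ⟨a, ρ, rfl⟩ := hQ.exists_eq_pt p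
    have hfl : (⌊(⌊ρ⌋ : ℝ) + 1 / 2⌋ : ℤ) = ⌊ρ⌋ := by
      rw [Int.floor_intCast_add]
      norm_num
    have hce : (⌈(⌊ρ⌋ : ℝ) + 1 / 2⌉ : ℤ) = ⌊ρ⌋ + 1 := by
      rw [Int.ceil_intCast_add]
      norm_num
    have hlt : ⌊(⌊ρ⌋ : ℝ) + 1 / 2⌋ < ⌈(⌊ρ⌋ : ℝ) + 1 / 2⌉ := by rw [hfl, hce]; lia
    -- For integral `ρ` the alcove above is chosen: it has the same floor, so it stays in the
    -- neighbourhood, whereas the one below might not.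
    refine ⟨hQ.pt a (⌊ρ⌋ + 1 / 2), Set.mem_sUnion.mpr
      ⟨_, ⟨hQ.isAlcove_facet_pt a hlt, alcoveDist_facet_le hQ hw hlt ?_⟩, rfl⟩, ?_⟩
    · rw [pt_mem_nbhd_iff_floor hQ hw] at hp ⊢
      rwa [hfl]
    · refine hQ.chain_subset_iff.mpr ⟨hfl.le, hce ▸ Int.ceil_le_floor_add_one ρ, ?_⟩
      rw [sub_self, norm_zero]
      exact (zpow_pos hQ.pos _).le
  · refine cl_subset_nbhd hQ hw (Set.sUnion_subset ?_)
    rintro A ⟨-, hA⟩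
    exact subset_nbhd_of_alcoveDist_le hQ hw hA

end Neighbourhood

end BT

/-! ### The fixed points as a neighbourhood of the image -/

theorem mainTheorem6 {F E : Type*} [NontriviallyNormedField F] [IsUltrametricDist F]
    [ProperSpace F] [CharP F 2] [NormedField E] [NormedAlgebra F E] [FiniteDimensional F E]
    (hdeg : Module.finrank F E = 2) (hram : BT.IsTotallyRamified F E)
    (d : ℕ) (hdisc : BT.discIdeal F E = IsLocalRing.maximalIdeal 𝒪[F] ^ (d + 1))
    (τ : E ≃ₐ[F] E) (hτ : τ ≠ 1) :
    {p : BT.Building E | BT.galois τ p = p} =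
      BT.cl (⋃₀ {A : Set (BT.Building E) |
        BT.IsAlcove A ∧ BT.alcoveDist A (Set.range (BT.iota F E)) ≤ (d : ℕ∞)}) := by
  have : IsUltrametricDist E := IsUltrametricDist.of_normedAlgebra F
  obtain ⟨Q, hQ, hle, happrox⟩ := BT.exists_valueGenerator hdeg hram d hdisc τ hτ
  have hQd : 0 < Q ^ d := pow_pos hQ.pos d
  have hw : BT.IsHeight Q fun a : E => ‖τ a - a‖ * Q ^ d := by
    refine ⟨hle, fun a b => ?_, fun a => ?_⟩
    · rw [← max_mul_of_nonneg _ _ hQd.le, map_add, add_sub_add_comm]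
      gcongr
      exact IsUltrametricDist.norm_add_le_max _ _
    · by_cases h : τ a - a = 0
      · simp [h]
      · obtain ⟨n, hn⟩ := hQ.norm_eq _ h
        refine Or.inr ⟨n + d, ?_⟩
        rw [hn, zpow_add₀ hQ.pos.ne', zpow_natCast]
  have hrange : Set.range (BT.iota F E) = BT.nbhd hQ (fun a : E => ‖τ a - a‖ * Q ^ d) 0 := by
    rw [BT.range_iota]
    ext p
    constructor
    · rintro ⟨a, r, hr, rfl⟩
      rw [hQ.disc_eq_pt, BT.pt_mem_nbhd hQ hw]
      simp [(Real.rpow_pos_of_pos hQ.pos _).le]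
    · rintro ⟨a, ρ, rfl, h⟩
      -- The disc contains a point of `F`, which can serve as its centre.
      obtain ⟨x, hx⟩ := happrox a
      exact ⟨x, _, Real.rpow_pos_of_pos hQ.pos ρ,
        hQ.pt_eq_pt_iff.mpr ⟨rfl, hx.trans (by simpa using h)⟩⟩
  rw [hrange, ← BT.nbhd_eq_cl hQ hw]
  ext p
  obtain ⟨a, ρ, rfl⟩ := hQ.exists_eq_pt p
  have hgal : BT.galois τ (hQ.pt a ρ) = hQ.pt (τ a) ρ := BT.galois_disc τ a _ _
  -- The factor `Q ^ d` cancels on both sides, leaving the condition `‖τ a - a‖ ≤ Q ^ ρ` for being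
  -- fixed.
  rw [BT.pt_mem_nbhd hQ hw, Set.mem_ofPred_eq, hgal, hQ.pt_eq_pt_iff, Real.rpow_add hQ.pos,
    Real.rpow_natCast, mul_le_mul_iff_left₀ hQd]
  exact and_iff_right rfl
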